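/- **Setting.** Let $G=(V,E,\mathbb L)$ be an edge-labeled directed graph with $V$ finite and $E\subseteq V\times\mathbb L\times V$ finite. Paths have length at least $1$ and may repeat vertices and edges. For label sequences, $L'$ is a *repeat* of $L$ if $L=(L')^z$ for some integer $z\ge 1$; the *minimum repeat* $MR(L)$ is the (unique) shortest repeat of $L$. A path satisfies the constraint $L^+$ if the minimum repeat of its label sequence is $L$. **Indexing algorithm with parameter $k\ge1$.** The index consists of sets $\mathcal L_{out}(v),\mathcal L_{in}(v)$ ($v\in V$) of pairs (vertex, label sequence), all initially empty. The vertices are listed in some access order (for instance by decreasing $(|out(v)|+1)(|in(v)|+1)$, where $out(v)$ and $in(v)$ are the sets of vertices that $v$ reaches and that reach $v$), and $aid(v)\ge 1$ is the position of $v$. For each vertex $v$, by increasing $aid$, a backward and then a forward search from $v$ is performed. *Backward search from $v$.* (a) Kernel-search: start a queue with $(v,\epsilon)$. While the queue is non-empty, dequeue $(x,seq)$, and for every edge $(y,a,x)$: let $seq'=a\circ seq$ and $L=MR(seq')$; call $\mathrm{insert}(y,v,L)$; add $y$ to the frontier set of the kernel candidate $L$; and if $|seq'|<k$, enqueue $(y,seq')$.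 (b) Kernel-BFS: for each kernel candidate $L$ found in (a), mark every $x$ in its frontier set as visited by state $1$ and enqueue $(x,1)$. While the queue is non-empty, dequeue $(x,j)$, put $i=j-1$ if $j>1$ and $i=|L|$ if $j=1$, and for every edge $(y,a,x)$ such that $a$ is the $i$-th label of $L$ and $y$ is not yet visited by state $i$: if $i=1$, call $\mathrm{insert}(y,v,L)$ and, if the entry is not added, skip $y$; if $y$ is not skipped, mark $y$ as visited by state $i$ and enqueue $(y,i)$. *Insertion.* $\mathrm{insert}(y,v,L)$ in the backward search from $v$ adds $(v,L)$ to $\mathcal L_{out}(y)$, unless $aid(v)>aid(y)$ or the current index already satisfies condition (1) or (2) below for $(s,t)=(y,v)$. The forward search is the mirror image: it follows out-going edges, appends labels at the end of $seq$, reads $L$ cyclically from left to right (the state in which a copy of $L$ is complete is $|L|$), and adds $(v,L)$ to $\mathcal L_{in}(y)$, unless $aid(v)>aid(y)$ or the current index already satisfies (1) or (2) for $(s,t)=(v,y)$. **Theorem.** Let $k$ be a positive integer, and let $\mathcal L_{out},\mathcal L_{in}$ be the index of $G$ built by this algorithm, for any access order and any order in which its loops run through edges, kernel candidates and frontier vertices.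 Let $s,t\in V$ and let $L$ be a label sequence with $|L|\le k$. Then there is a path from $s$ to $t$ in $G$ that satisfies $L^+$ if and only if one of the following conditions holds: 1. there is $x\in V$ with $(x,L)\in\mathcal L_{out}(s)$ and $(x,L)\in\mathcal L_{in}(t)$; 2. $(t,L)\in\mathcal L_{out}(s)$ or $(s,L)\in\mathcal L_{in}(t)$. -/

import Mathlib

namespace RLC

/-- An edge-labeled directed graph on the vertex type `V` with labels in `Lab`:
a finite set of triples (source, label, target). -/
structure LabeledGraph (V Lab : Type*) where
  edges : Finset (V × Lab × V)

/-- Arbitrary paths (vertices and edges may repeat) with at least one edge. -/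
inductive Path {V Lab : Type*} (G : LabeledGraph V Lab) : V → V → Type _
  | single {u v : V} (a : Lab) (h : (u, a, v) ∈ G.edges) : Path G u v
  | cons {u w v : V} (a : Lab) (h : (u, a, w) ∈ G.edges) (p : Path G w v) : Path G u v

/-- The label sequence of a path. -/
def Path.labels {V Lab : Type*} {G : LabeledGraph V Lab} :
    {u v : V} → Path G u v → List Lab
  | _, _, .single a _ => [a]
  | _, _, .cons a _ p => a :: p.labels

/-- `L'` is a repeat of `L`: `L` consists of `z ≥ 1` consecutive copies of `L'`. -/
def IsRepeat {Lab : Type*} (L' L : List Lab) : Prop :=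
  ∃ z : ℕ, 1 ≤ z ∧ L = (List.replicate z L').flatten

/-- `L'` is a repeat of `L` of the shortest length among all repeats of `L`. -/
def IsMinRepeat {Lab : Type*} (L' L : List Lab) : Prop :=
  IsRepeat L' L ∧ ∀ L'' : List Lab, IsRepeat L'' L → L'.length ≤ L''.length

theorem exists_isMinRepeat {Lab : Type*} (L : List Lab) : ∃ L', IsMinRepeat L' L := by
  have hne : {M : List Lab | IsRepeat M L}.Nonempty := ⟨L, 1, le_rfl, by simp⟩
  refine ⟨Function.argminOn List.length _ hne, Function.argminOn_mem List.length _ hne, ?_⟩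
  intro M hM
  exact Function.argminOn_le List.length {M : List Lab | IsRepeat M L} hM

/-- The minimum repeat `MR(L)`. -/
noncomputable def MR {Lab : Type*} (L : List Lab) : List Lab :=
  Classical.choose (exists_isMinRepeat L)

theorem isMinRepeat_MR {Lab : Type*} (L : List Lab) : IsMinRepeat (MR L) L :=
  Classical.choose_spec (exists_isMinRepeat L)

/-- The minimum repeat is unique, so that `MR L` does not depend on a choice. -/
theorem IsMinRepeat.eq_MR {Lab : Type*} {L' L : List Lab} (h : IsMinRepeat L' L) :
    L' = MR L := by
  have h2 := isMinRepeat_MR L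
  have hlen : L'.length = (MR L).length := le_antisymm (h.2 _ h2.1) (h2.2 _ h.1)
  have key : ∀ M : List Lab, IsRepeat M L → M <+: L := by
    rintro M ⟨z, hz, hL⟩
    obtain ⟨y, rfl⟩ : ∃ y, z = y + 1 := ⟨z - 1, by omega⟩
    rw [hL, List.replicate_succ, List.flatten_cons]
    exact List.prefix_append _ _
  exact (List.prefix_of_prefix_length_le (key _ h.1) (key _ h2.1) hlen.le).eq_of_length hlen

/-- `s` reaches `t` under the constraint `L⁺`: some path from `s` to `t` has a label sequence
whose minimum repeat is `L`. -/
def ReachesPlus {V Lab : Type*} (G : LabeledGraph V Lab) (L : List Lab) (s t : V) : Prop :=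
  ∃ p : Path G s t, MR p.labels = L

/-- Direction of a search: backward along in-coming edges, forward along out-going edges. -/
inductive Dir
  | backward
  | forward

/-- The order choices that a run of the indexing algorithm makes: the access order of the
vertices, and the orders in which the `for` loops run through adjacent edges, through the
kernel candidates found from a root, and through the frontier vertices of a kernel candidate.
Nothing is required of these orders but that they list the right elements, once each. -/
structure Schedule {V Lab : Type*} (G : LabeledGraph V Lab) where
  /-- all vertices, by increasing access id -/
  order : List V
  order_nodup : order.Nodup
  mem_order : ∀ v, v ∈ order
  /-- in-coming (resp. out-going) edges of a vertex, as pairs (other endpoint, label) -/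
  adj : Dir → V → List (V × Lab)
  adj_nodup : ∀ d x, (adj d x).Nodup
  mem_adj_backward : ∀ x y a, (y, a) ∈ adj .backward x ↔ (y, a, x) ∈ G.edges
  mem_adj_forward : ∀ x y a, (y, a) ∈ adj .forward x ↔ (x, a, y) ∈ G.edges
  /-- order of the kernel candidates in the search from a given root -/
  kernels : V → Dir → Finset (List Lab) → List (List Lab)
  kernels_nodup : ∀ v d K, (kernels v d K).Nodup
  mem_kernels : ∀ v d K L, L ∈ kernels v d K ↔ L ∈ K
  /-- order of the frontier vertices, for a given root and kernel candidate -/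
  frontier : V → Dir → List Lab → Finset V → List V
  frontier_nodup : ∀ v d L F, (frontier v d L F).Nodup
  mem_frontier : ∀ v d L F x, x ∈ frontier v d L F ↔ x ∈ F

theorem nonempty_schedule {V Lab : Type*} [Fintype V] (G : LabeledGraph V Lab) :
    Nonempty (Schedule G) := by
  classical
  refine ⟨{
    order := Finset.univ.toList
    order_nodup := Finset.nodup_toList _
    mem_order := by simp
    adj := fun d x => match d with
      | .backward => ((G.edges.filter (fun e => e.2.2 = x)).image
          (fun e => (e.1, e.2.1))).toList
      | .forward => ((G.edges.filter (fun e => e.1 = x)).image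
          (fun e => (e.2.2, e.2.1))).toList
    adj_nodup := by rintro (_ | _) x <;> exact Finset.nodup_toList _
    mem_adj_backward := by simp
    mem_adj_forward := by simp
    kernels := fun _ _ K => K.toList
    kernels_nodup := fun _ _ _ => Finset.nodup_toList _
    mem_kernels := by simp
    frontier := fun _ _ _ F => F.toList
    frontier_nodup := fun _ _ _ _ => Finset.nodup_toList _
    mem_frontier := by simp }⟩

/-- A snapshot of the index: the sets `L_out(v)` and `L_in(v)` of entries (vertex, label
sequence). -/
structure Index (V Lab : Type*) where
  lout : V → Finset (V × List Lab)
  lin : V → Finset (V × List Lab)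

/-- The index without entries. -/
def Index.empty (V Lab : Type*) : Index V Lab := ⟨fun _ => ∅, fun _ => ∅⟩

/-- Success of the query `(s, t, L⁺)` on a snapshot of the index. -/
def Query {V Lab : Type*} (I : Index V Lab) (s t : V) (L : List Lab) : Prop :=
  ((t, L) ∈ I.lout s ∨ (s, L) ∈ I.lin t) ∨ ∃ x, (x, L) ∈ I.lout s ∧ (x, L) ∈ I.lin t

instance {V Lab : Type*} [Fintype V] [DecidableEq V] [DecidableEq Lab] (I : Index V Lab)
    (s t : V) (L : List Lab) : Decidable (Query I s t L) := by
  unfold Query; infer_instance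

/-- The state `1, …, |L|` of a vertex is the position in `L` of the label read last. A copy of
`L` is complete in state `1` for the backward search, in state `|L|` for the forward search. -/
def finalState {Lab : Type*} (d : Dir) (L : List Lab) : ℕ :=
  match d with
  | .backward => 1
  | .forward => L.length

/-- The position in `L` of the label to be read next. -/
def nextState {Lab : Type*} (d : Dir) (L : List Lab) (i : ℕ) : ℕ :=
  match d with
  | .backward => if i - 1 = 0 then L.length else i - 1
  | .forward => if i = L.length then 1 else i + 1

theorem one_le_nextState {Lab : Type*} (d : Dir) (L : List Lab) (i : ℕ) : 1 ≤ nextState d L i ∨ L = [] := by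
  cases L with
  | nil => exact Or.inr rfl
  | cons a L => left; cases d <;> simp only [nextState, List.length_cons] <;> split_ifs <;> omega

section Algorithm

variable {V Lab : Type*} [Fintype V] [DecidableEq V] [DecidableEq Lab]
  {G : LabeledGraph V Lab}

/-- The access id of a vertex, starting from `1`. -/
def Schedule.aid (S : Schedule G) (v : V) : ℕ := S.order.idxOf v + 1

/-- The `insert` procedure for the search from root `v` that visits `y`. The backward search
tries to add `(v, L)` to `L_out(y)`, the forward search tries to add `(v, L)` to `L_in(y)`. The
entry is skipped if `v` has a larger access id than `y`, or if the current snapshot already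
answers the query. The Boolean tells whether the entry was added. -/
def insertEntry (S : Schedule G) (d : Dir) (v y : V) (L : List Lab) (I : Index V Lab) :
    Index V Lab × Bool :=
  match d with
  | .backward =>
      if S.aid v > S.aid y ∨ Query I y v L then (I, false)
      else ({ I with lout := Function.update I.lout y (insert (v, L) (I.lout y)) }, true)
  | .forward =>
      if S.aid v > S.aid y ∨ Query I v y L then (I, false)
      else ({ I with lin := Function.update I.lin y (insert (v, L) (I.lin y)) }, true)

/-! ### Kernel-search phase -/

/-- Extend the label sequence read so far by the label of the edge just traversed. -/
def extendSeq (d : Dir) (a : Lab) (seq : List Lab) : List Lab :=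
  match d with
  | .backward => a :: seq
  | .forward => seq ++ [a]

/-- Variables of the kernel-search: the index, the map from kernel candidates to their frontier
vertices (as a set of pairs), and the queue. -/
structure SearchState (V Lab : Type*) where
  index : Index V Lab
  map : Finset (List Lab × V)
  queue : List (V × List Lab)

/-- Body of the `for` loop over the edges at the dequeued vertex, reached by `seq`. -/
noncomputable def searchEdge (S : Schedule G) (k : ℕ) (d : Dir) (v : V) (seq : List Lab)
    (st : SearchState V Lab) (e : V × Lab) : SearchState V Lab :=
  let seq' := extendSeq d e.2 seq
  let L := MR seq'
  { index := (insertEntry S d v e.1 L st.index).1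
    map := insert (L, e.1) st.map
    queue := if seq'.length < k then st.queue ++ [(e.1, seq')] else st.queue }

/-- The `for` loop over the edges at the dequeued vertex `x`, reached by `seq`. -/
noncomputable def searchEdges (S : Schedule G) (k : ℕ) (d : Dir) (v x : V) (seq : List Lab)
    (st : SearchState V Lab) : SearchState V Lab :=
  (S.adj d x).foldl (searchEdge S k d v seq) st

/-- Termination measure of the kernel-search. -/
def searchWeight (S : Schedule G) (k : ℕ) (d : Dir) (q : List (V × List Lab)) : ℕ :=
  (q.map fun p =>
    ((Finset.univ.sup fun x => (S.adj d x).length) + 1) ^ (k - p.2.length)).sum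

theorem searchWeight_foldl_le (S : Schedule G) (k : ℕ) (d : Dir) (v : V) (seq : List Lab)
    (l : List (V × Lab)) (st : SearchState V Lab) :
    searchWeight S k d (l.foldl (searchEdge S k d v seq) st).queue ≤
      searchWeight S k d st.queue + l.length *
        (if seq.length + 1 < k then
          ((Finset.univ.sup fun x => (S.adj d x).length) + 1) ^ (k - (seq.length + 1))
        else 0) := by
  induction l generalizing st with
  | nil => simp
  | cons e l ih =>
    refine (ih _).trans ?_
    have hlen : (extendSeq d e.2 seq).length = seq.length + 1 := by cases d <;> simp [extendSeq]
    simp only [searchEdge, hlen, List.length_cons, Nat.add_mul, Nat.one_mul]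
    split_ifs with h
    · simp [searchWeight, hlen]; omega
    · simp

theorem searchWeight_lt (S : Schedule G) (k : ℕ) (d : Dir) (v x : V) (seq : List Lab)
    (I : Index V Lab) (m : Finset (List Lab × V)) (q : List (V × List Lab)) :
    searchWeight S k d (searchEdges S k d v x seq ⟨I, m, q⟩).queue <
      searchWeight S k d ((x, seq) :: q) := by
  refine (searchWeight_foldl_le S k d v seq _ _).trans_lt ?_
  have hB : (S.adj d x).length ≤ Finset.univ.sup fun x => (S.adj d x).length :=
    Finset.le_sup (f := fun x => (S.adj d x).length) (Finset.mem_univ x)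
  simp only [searchWeight, List.map_cons, List.sum_cons]
  generalize (Finset.univ.sup fun x => (S.adj d x).length) = B at hB ⊢
  rw [Nat.add_comm]
  refine Nat.add_lt_add_right ?_ _
  split_ifs with h
  · have hk : k - seq.length = (k - (seq.length + 1)) + 1 := by omega
    rw [hk, pow_succ, Nat.mul_comm]
    exact Nat.mul_lt_mul_of_pos_left (by omega) (by positivity)
  · simp

/-- The `while` loop of the kernel-search from root `v`. -/
noncomputable def searchLoop (S : Schedule G) (k : ℕ) (d : Dir) (v : V)
    (I : Index V Lab) (m : Finset (List Lab × V)) :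
    List (V × List Lab) → Index V Lab × Finset (List Lab × V)
  | [] => (I, m)
  | (x, seq) :: q =>
      let st := searchEdges S k d v x seq ⟨I, m, q⟩
      searchLoop S k d v st.index st.map st.queue
termination_by q => searchWeight S k d q
decreasing_by exact searchWeight_lt S k d v x seq I m q

/-- The kernel-search from root `v`: it inserts index entries and returns the kernel candidates
with their frontier vertices. -/
noncomputable def kernelSearch (S : Schedule G) (k : ℕ) (d : Dir) (v : V) (I : Index V Lab) :
    Index V Lab × Finset (List Lab × V) :=
  searchLoop S k d v I ∅ [(v, [])]

/-! ### Kernel-BFS phase -/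

/-- Variables of the kernel-BFS: the index, the pairs (vertex, state) marked as visited, and the
queue. -/
structure BFSState (V Lab : Type*) where
  index : Index V Lab
  visited : Finset (V × ℕ)
  queue : List (V × ℕ)

/-- Body of the `for` loop over the edges at the dequeued vertex: `i` is the position of the
label that has to be read. If a copy of `L` is completed and the entry is not inserted, then the
vertex is pruned. -/
def bfsEdge (S : Schedule G) (d : Dir) (v : V) (L : List Lab) (i : ℕ)
    (st : BFSState V Lab) (e : V × Lab) : BFSState V Lab :=
  if L[i - 1]? ≠ some e.2 ∨ (e.1, i) ∈ st.visited then st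
  else if i = finalState d L then
    let r := insertEntry S d v e.1 L st.index
    if r.2 = false then { st with index := r.1 }
    else ⟨r.1, insert (e.1, i) st.visited, st.queue ++ [(e.1, i)]⟩
  else ⟨st.index, insert (e.1, i) st.visited, st.queue ++ [(e.1, i)]⟩

/-- The `for` loop over the edges at the dequeued vertex `x`. -/
def bfsEdges (S : Schedule G) (d : Dir) (v x : V) (L : List Lab) (i : ℕ)
    (st : BFSState V Lab) : BFSState V Lab :=
  (S.adj d x).foldl (bfsEdge S d v L i) st

/-- Termination measure of the kernel-BFS. -/
def bfsWeight (L : List Lab) (visited : Finset (V × ℕ)) (q : List (V × ℕ)) : ℕ :=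
  q.length + (((Finset.univ : Finset V) ×ˢ Finset.Icc 1 L.length) \ visited).card

theorem bfsWeight_insert (L : List Lab) (visited : Finset (V × ℕ)) (q : List (V × ℕ))
    (y : V) (i : ℕ) (h1 : 1 ≤ i) (h2 : i ≤ L.length) (h : (y, i) ∉ visited) :
    bfsWeight L (insert (y, i) visited) (q ++ [(y, i)]) ≤ bfsWeight L visited q := by
  have hm : (y, i) ∈ ((Finset.univ : Finset V) ×ˢ Finset.Icc 1 L.length) \ visited := by
    simp [h, h1, h2]
  have hc := Finset.card_erase_add_one hm
  rw [bfsWeight, bfsWeight, Finset.sdiff_insert]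
  simp only [List.length_append, List.length_singleton]
  omega

theorem bfsWeight_foldl_le (S : Schedule G) (d : Dir) (v : V) (L : List Lab) (i : ℕ)
    (hi : 1 ≤ i ∨ L = []) (l : List (V × Lab)) (st : BFSState V Lab) :
    bfsWeight L (l.foldl (bfsEdge S d v L i) st).visited
      (l.foldl (bfsEdge S d v L i) st).queue ≤ bfsWeight L st.visited st.queue := by
  induction l generalizing st with
  | nil => exact le_rfl
  | cons e l ih =>
    refine (ih _).trans ?_
    unfold bfsEdge
    by_cases h1 : L[i - 1]? ≠ some e.2 ∨ (e.1, i) ∈ st.visited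
    · rw [if_pos h1]
    · rw [if_neg h1]
      push Not at h1
      obtain ⟨hlt, -⟩ := List.getElem?_eq_some_iff.1 h1.1
      have hi' : 1 ≤ i := hi.resolve_right (fun h0 => by simp [h0] at hlt)
      have hins := bfsWeight_insert L st.visited st.queue e.1 i hi' (by omega) h1.2
      dsimp only
      split_ifs
      · exact le_rfl
      · exact hins
      · exact hins

/-- The `while` loop of the kernel-BFS from root `v` guided by `L⁺`. -/
def bfsLoop (S : Schedule G) (d : Dir) (v : V) (L : List Lab) (I : Index V Lab)
    (visited : Finset (V × ℕ)) : List (V × ℕ) → Index V Lab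
  | [] => I
  | (x, i) :: q =>
      let st := bfsEdges S d v x L (nextState d L i) ⟨I, visited, q⟩
      bfsLoop S d v L st.index st.visited st.queue
termination_by q => bfsWeight L visited q
decreasing_by
  refine (bfsWeight_foldl_le S d v L _ (one_le_nextState d L i) (S.adj d x)
    ⟨I, visited, q⟩).trans_lt ?_
  simp [bfsWeight]

/-- The kernel-BFS from root `v` guided by `L⁺`, started at the frontier vertices `F`. -/
def kernelBFS (S : Schedule G) (d : Dir) (v : V) (L : List Lab) (F : Finset V)
    (I : Index V Lab) : Index V Lab :=
  bfsLoop S d v L I (F.image fun x => (x, finalState d L))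
    ((S.frontier v d L F).map fun x => (x, finalState d L))

/-! ### The indexing algorithm -/

/-- Kernel-search from root `v` in one direction, followed by one kernel-BFS for each kernel
candidate. -/
noncomputable def directedSearch (S : Schedule G) (k : ℕ) (d : Dir) (v : V)
    (I : Index V Lab) : Index V Lab :=
  let r := kernelSearch S k d v I
  (S.kernels v d (r.2.image Prod.fst)).foldl
    (fun J L => kernelBFS S d v L ((r.2.filter fun p => p.1 = L).image Prod.snd) J) r.1

/-- The kernel-based search from `v`: first backward, then forward. -/
noncomputable def kernelBasedSearch (S : Schedule G) (k : ℕ) (I : Index V Lab) (v : V) :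
    Index V Lab :=
  directedSearch S k .forward v (directedSearch S k .backward v I)

/-- The index built by the indexing algorithm: kernel-based searches from all vertices, by
increasing access id. -/
noncomputable def buildIndex (S : Schedule G) (k : ℕ) : Index V Lab :=
  S.order.foldl (kernelBasedSearch S k) (Index.empty V Lab)

end Algorithm

end RLC

/-! The word combinatorics comes first: if a power of `L` is also a power of a word `M`, then `L`
and `M` commute and hence have a common root, so that `MR (Lᶻ) = L` whenever `MR L = L` (`MR_pow`).
Therefore `s` reaches `t` under `L⁺` if and only if `L ≠ []`, `MR L = L`, and `s` and `t` are
related by the transitive closure of "one copy of `L` leads from `x` to `y`" (`reachesPlus_iff`).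
From there on only this relation, `CopyStep`, matters. Backward and forward searches are treated
at once, by reading label sequences in the order in which the search meets them.

Soundness is an invariant: a search from `v` writes `(v, L)` at `y` only if copies of `L` connect
`v` and `y` (`grows_directedSearch`, `correct_buildIndex`), and two entries meeting at a vertex
compose by transitivity.

For completeness, let `v` have the smallest access id among all vertices that lie, at the ends of
copies of `L`, on some walk from `s` to `t` that reads copies of `L`, with `s` and `t` included. The
kernel-search from `v` does not prune and `|L| ≤ k`, so every vertex one copy of `L` away from `v` is
a frontier vertex. From a visited vertex the kernel-BFS visits the end of every further copy of `L`
unless the insertion there is refused (`exists_passed_directedSearch`). A refusal has one of three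
causes. The entry `(v, L)` itself may be present already; then the vertex is marked as visited, which
is an invariant of both phases. The vertex may have a smaller access id than `v`, or the query may
be answered without the entry `(v, L)` at this vertex; these causes are collected in `Blocked`. As
roots are processed by increasing access id, both would exhibit a vertex between `s` and `t` with
access id smaller than that of `v`. The only exception is that the forward search may be pruned at
`v` itself, because of the entry `(v, L)` in `L_out(v)`; then it suffices to look at the part of the
walk after the last passage through `v` (`mem_get_directedSearch_of_unblocked`). Hence `(v, L)`
belongs to `L_out(s)` if copies of `L` lead from `s` to `v`, and to `L_in(t)` if `t ≠ v` and copies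
of `L` lead from `v` to `t`. One of the query conditions follows, according to whether `v` is `t`,
`s` or neither. -/

namespace RLC

open Relation

/-! ### Minimum repeats -/

/-- Two commuting words are powers of a common word. -/
theorem exists_common_root {α : Type*} (u v : List α) (h : u ++ v = v ++ u) :
    ∃ (r : List α) (a b : ℕ), u = (List.replicate a r).flatten ∧
      v = (List.replicate b r).flatten := by
  induction hn : u.length + v.length using Nat.strong_induction_on generalizing u v with
  | _ n ih =>
    subst hn
    wlog hle : u.length ≤ v.length generalizing u v
    · obtain ⟨r, a, b, hv, hu⟩ := this v u h.symm
        (fun m hm => ih m (by omega)) (by omega)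
      exact ⟨r, b, a, hu, hv⟩
    rcases u with _ | ⟨c, u⟩
    · exact ⟨v, 0, 1, by simp, by simp⟩
    · obtain ⟨w, rfl⟩ : c :: u <+: v :=
        List.prefix_of_prefix_length_le (List.prefix_append _ _)
          (h ▸ List.prefix_append v (c :: u)) hle
      have hw : (c :: u) ++ w = w ++ (c :: u) := by
        rw [List.append_assoc] at h
        exact List.append_cancel_left h
      obtain ⟨r, a, b, hu, hv⟩ := ih _ (by simp) (c :: u) w hw rfl
      refine ⟨r, a, a + b, hu, ?_⟩
      rw [List.replicate_add, List.flatten_append, ← hu, ← hv]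

/-- Two nonempty powers of `u` and `v` can only agree if `u` and `v` commute: both products are
prefixes of the square of the common power. -/
theorem append_comm_of_pow_eq {α : Type*} {u v : List α} {m n : ℕ} (hm : 1 ≤ m) (hn : 1 ≤ n)
    (h : (List.replicate m u).flatten = (List.replicate n v).flatten) : u ++ v = v ++ u := by
  have aux : ∀ {u v : List α} {m n : ℕ}, 1 ≤ m → 1 ≤ n →
      (List.replicate m u).flatten = (List.replicate n v).flatten →
      u ++ v <+: (List.replicate m u).flatten ++ (List.replicate m u).flatten := by
    intro u v m n hm hn h
    obtain ⟨m, rfl⟩ : ∃ j, m = j + 1 := ⟨m - 1, by omega⟩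
    obtain ⟨n, rfl⟩ : ∃ j, n = j + 1 := ⟨n - 1, by omega⟩
    have hcomm : (List.replicate (m + 1) u).flatten ++ (List.replicate (m + 1) u).flatten =
        u ++ ((List.replicate (m + 1) u).flatten ++ (List.replicate m u).flatten) := by
      rw [← List.flatten_append, ← List.flatten_append, ← List.flatten_cons,
        ← List.replicate_add, ← List.replicate_add, ← List.replicate_succ]
      congr 2
    rw [hcomm, h, List.replicate_succ (a := v), List.flatten_cons, List.append_assoc,
      ← List.append_assoc u v]
    exact List.prefix_append _ _
  refine List.IsPrefix.eq_of_length (List.prefix_of_prefix_length_le (aux hm hn h) ?_ ?_) ?_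
  · rw [h]; exact aux hn hm h.symm
  · simp [Nat.add_comm]
  · simp [Nat.add_comm]

theorem IsRepeat.trans {α : Type*} {u v w : List α} (huv : IsRepeat u v) (hvw : IsRepeat v w) :
    IsRepeat u w := by
  obtain ⟨a, ha, rfl⟩ := huv
  obtain ⟨b, hb, rfl⟩ := hvw
  refine ⟨b * a, Nat.mul_pos hb ha, ?_⟩
  clear hb
  induction b with
  | zero => simp
  | succ b ih =>
    rw [List.replicate_succ, List.flatten_cons, ih, ← List.flatten_append, ← List.replicate_add]
    congr 2; ring

theorem MR_MR {α : Type*} (w : List α) : MR (MR w) = MR w := by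
  have h := isMinRepeat_MR w
  refine (IsMinRepeat.eq_MR ⟨⟨1, le_rfl, by simp⟩, fun M hM => ?_⟩).symm
  exact h.2 M (hM.trans h.1)

/-- The powers of a word that is its own minimum repeat have this word as minimum repeat. -/
theorem MR_pow {α : Type*} {L : List α} (hL : MR L = L) {z : ℕ} (hz : 1 ≤ z) :
    MR (List.replicate z L).flatten = L := by
  refine (IsMinRepeat.eq_MR ⟨⟨z, hz, rfl⟩, ?_⟩).symm
  rintro M ⟨n, hn, h⟩
  rcases eq_or_ne L [] with rfl | hne
  · simp
  obtain ⟨r, a, b, ha, hb⟩ := exists_common_root L M (append_comm_of_pow_eq hz hn h)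
  have ha0 : 1 ≤ a := by
    rcases a with _ | a
    · exact absurd (by simpa using ha) hne
    · omega
  have hb0 : 1 ≤ b := by
    rcases b with _ | b
    · subst hb
      have h' : L.length = 0 ∨ z = 0 := by
        have := congrArg List.length h
        simp at this
        tauto
      rcases h' with h' | h'
      · exact absurd (List.length_eq_zero_iff.1 h') hne
      · omega
    · omega
  have hmin := (isMinRepeat_MR L).2 r ⟨a, ha0, ha⟩
  rw [hL] at hmin
  refine hmin.trans ?_
  rw [hb]
  simpa using Nat.le_mul_of_pos_left r.length hb0

theorem MR_ne_nil {α : Type*} {w : List α} (hw : w ≠ []) : MR w ≠ [] := by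
  obtain ⟨z, -, h⟩ := (isMinRepeat_MR w).1
  intro h0
  rw [h0] at h
  exact hw (by simpa using h)

/-! ### Walks in reading order -/

/-- The opposite direction. -/
def Dir.flip : Dir → Dir
  | .backward => .forward
  | .forward => .backward

/-- Passage between a label sequence along the edges and the same sequence in the order in which
a search in direction `d` reads it. -/
def orient {Lab : Type*} (d : Dir) (w : List Lab) : List Lab :=
  match d with
  | .backward => w.reverse
  | .forward => w

@[simp] theorem orient_orient {Lab : Type*} (d : Dir) (w : List Lab) :
    orient d (orient d w) = w := by
  cases d <;> simp [orient]

@[simp] theorem length_orient {Lab : Type*} (d : Dir) (w : List Lab) :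
    (orient d w).length = w.length := by
  cases d <;> simp [orient]

@[simp] theorem orient_eq_nil {Lab : Type*} (d : Dir) (w : List Lab) :
    orient d w = [] ↔ w = [] := by
  cases d <;> simp [orient]

theorem orient_pow {Lab : Type*} (d : Dir) (z : ℕ) (w : List Lab) :
    orient d (List.replicate z w).flatten = (List.replicate z (orient d w)).flatten := by
  cases d <;> simp [orient, List.reverse_flatten]

theorem orient_extendSeq {Lab : Type*} (d : Dir) (a : Lab) (w : List Lab) :
    orient d (extendSeq d a w) = orient d w ++ [a] := by
  cases d <;> simp [orient, extendSeq]

/-- `y` can be reached from `x` by following edges in direction `d`, reading the labels of `w` in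
this order. -/
def ReadWalk {V Lab : Type*} {G : LabeledGraph V Lab} (S : Schedule G) (d : Dir) :
    List Lab → V → V → Prop
  | [], x, y => x = y
  | a :: w, x, y => ∃ z, (z, a) ∈ S.adj d x ∧ ReadWalk S d w z y

section Walks

variable {V Lab : Type*} {G : LabeledGraph V Lab} (S : Schedule G)

theorem readWalk_append (d : Dir) (u w : List Lab) (x y : V) :
    ReadWalk S d (u ++ w) x y ↔ ∃ z, ReadWalk S d u x z ∧ ReadWalk S d w z y := by
  induction u generalizing x with
  | nil => simp [ReadWalk]
  | cons a u ih =>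
    simp only [List.cons_append, ReadWalk, ih]
    constructor
    · rintro ⟨z, hz, t, h1, h2⟩; exact ⟨t, ⟨z, hz, h1⟩, h2⟩
    · rintro ⟨t, ⟨z, hz, h1⟩, h2⟩; exact ⟨z, hz, t, h1, h2⟩

theorem readWalk_singleton (d : Dir) (a : Lab) (x y : V) :
    ReadWalk S d [a] x y ↔ (y, a) ∈ S.adj d x := by
  simp [ReadWalk]

theorem readWalk_backward (w : List Lab) (x y : V) :
    ReadWalk S .backward w x y ↔ ReadWalk S .forward w.reverse y x := by
  induction w generalizing x with
  | nil => simp [ReadWalk, eq_comm]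
  | cons a w ih =>
    simp only [ReadWalk, List.reverse_cons, readWalk_append, ih, exists_eq_right,
      S.mem_adj_backward, S.mem_adj_forward]
    constructor
    · rintro ⟨z, h1, h2⟩; exact ⟨z, h2, h1⟩
    · rintro ⟨z, h1, h2⟩; exact ⟨z, h2, h1⟩

theorem exists_path_iff (w : List Lab) (s t : V) :
    (∃ p : Path G s t, p.labels = w) ↔ w ≠ [] ∧ ReadWalk S .forward w s t := by
  constructor
  · rintro ⟨p, rfl⟩
    induction p with
    | single a h =>
      exact ⟨by simp [Path.labels],
        (readWalk_singleton S _ _ _ _).2 ((S.mem_adj_forward _ _ _).2 h)⟩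
    | cons a h p ih =>
      exact ⟨by simp [Path.labels], _, (S.mem_adj_forward _ _ _).2 h, ih.2⟩
  · rintro ⟨hne, hw⟩
    induction w generalizing s with
    | nil => exact absurd rfl hne
    | cons a w ih =>
      obtain ⟨z, hz, hw⟩ := hw
      rw [S.mem_adj_forward] at hz
      rcases eq_or_ne w [] with rfl | hne'
      · obtain rfl : z = t := hw
        exact ⟨.single a hz, rfl⟩
      · obtain ⟨p, rfl⟩ := ih z hne' hw
        exact ⟨.cons a hz p, rfl⟩

/-! ### Concatenations of copies of a label sequence -/

/-- One copy of `L` is read along some walk from `x` to `y` in direction `d`. -/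
def CopyStep (d : Dir) (L : List Lab) (x y : V) : Prop :=
  ReadWalk S d (orient d L) x y

theorem copyStep_backward (L : List Lab) (x y : V) :
    CopyStep S .backward L x y ↔ CopyStep S .forward L y x := by
  simp [CopyStep, readWalk_backward, orient]

theorem transGen_copyStep_backward (L : List Lab) (x y : V) :
    TransGen (CopyStep S .backward L) x y ↔ TransGen (CopyStep S .forward L) y x := by
  rw [← transGen_swap]
  have : Function.swap (CopyStep S .backward L) = CopyStep S .forward L := by
    ext a b; exact copyStep_backward S L b a
  rw [this]

theorem reflTransGen_of_readWalk_pow {d : Dir} {w : List Lab} {z : ℕ} {x y : V}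
    (h : ReadWalk S d (List.replicate z w).flatten x y) :
    ReflTransGen (ReadWalk S d w) x y := by
  induction z generalizing x with
  | zero => obtain rfl : x = y := by simpa [ReadWalk] using h
            exact .refl
  | succ z ih =>
    rw [List.replicate_succ, List.flatten_cons, readWalk_append] at h
    obtain ⟨t, h1, h2⟩ := h
    exact (ih h2).head h1

theorem transGen_of_readWalk_pow {d : Dir} {w : List Lab} {z : ℕ} (hz : 1 ≤ z) {x y : V}
    (h : ReadWalk S d (List.replicate z w).flatten x y) : TransGen (ReadWalk S d w) x y := by
  obtain ⟨z, rfl⟩ : ∃ j, z = j + 1 := ⟨z - 1, by omega⟩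
  rw [List.replicate_succ, List.flatten_cons, readWalk_append] at h
  obtain ⟨t, h1, h2⟩ := h
  exact .head' h1 (reflTransGen_of_readWalk_pow S h2)

theorem exists_readWalk_pow_of_transGen {d : Dir} {w : List Lab} {x y : V}
    (h : TransGen (ReadWalk S d w) x y) :
    ∃ z, 1 ≤ z ∧ ReadWalk S d (List.replicate z w).flatten x y := by
  induction h with
  | single h => exact ⟨1, le_rfl, by simpa using h⟩
  | tail _ h ih =>
    obtain ⟨z, -, hw⟩ := ih
    refine ⟨z + 1, by omega, ?_⟩
    rw [List.replicate_succ', List.flatten_append, readWalk_append]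
    exact ⟨_, hw, by simpa using h⟩

/-- The entry `(v, L)` at `y` is correct for a search in direction `d`: `y` is reached from the
root `v` along a walk that reads copies of `L`, and `L` is its own minimum repeat. -/
def Sound (d : Dir) (v : V) (L : List Lab) (y : V) : Prop :=
  L ≠ [] ∧ MR L = L ∧ TransGen (CopyStep S d L) v y

/-- Reachability under `L⁺` is reachability by copies of `L`, because all powers of a minimum
repeat have the same minimum repeat. -/
theorem reachesPlus_iff (L : List Lab) (s t : V) :
    ReachesPlus G L s t ↔ Sound S .forward s L t := by
  constructor
  · rintro ⟨p, rfl⟩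
    obtain ⟨hne, hw⟩ := (exists_path_iff S p.labels s t).1 ⟨p, rfl⟩
    refine ⟨MR_ne_nil hne, MR_MR _, ?_⟩
    obtain ⟨z, hz, hp⟩ := (isMinRepeat_MR p.labels).1
    rw [hp] at hw
    exact transGen_of_readWalk_pow S hz hw
  · rintro ⟨hne, hM, ht⟩
    obtain ⟨z, hz, hw⟩ := exists_readWalk_pow_of_transGen S ht
    have hne' : (List.replicate z L).flatten ≠ [] := by
      simp [hne]; omega
    obtain ⟨p, hp⟩ := (exists_path_iff S _ s t).2 ⟨hne', hw⟩
    exact ⟨p, by rw [hp]; exact MR_pow hM hz⟩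

/-- Every sequence read from `v` gives a correct entry, for its minimum repeat. -/
theorem sound_of_readWalk {d : Dir} {w : List Lab} (hne : w ≠ []) {v y : V}
    (h : ReadWalk S d (orient d w) v y) : Sound S d v (MR w) y := by
  refine ⟨MR_ne_nil hne, MR_MR _, ?_⟩
  obtain ⟨z, hz, hp⟩ := (isMinRepeat_MR w).1
  rw [hp, orient_pow] at h
  exact transGen_of_readWalk_pow S hz h

end Walks


section Searches

variable {V Lab : Type*} {G : LabeledGraph V Lab} {S : Schedule G} {d : Dir} {v : V}
  {L : List Lab}

/-! ### States of the kernel-BFS -/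

/-- The state of a vertex once `j ≥ 1` labels of a copy of `L` have been read, for `|L| = n`. -/
def readState (d : Dir) (n j : ℕ) : ℕ :=
  match d with
  | .backward => n - j + 1
  | .forward => j

/-- `x` in state `i` is correct: `x` is reached from `v` by some copies of `L`, the last of which
may be incomplete and stops at position `i`. -/
def StateWalk (S : Schedule G) (d : Dir) (v : V) (L : List Lab) (x : V) (i : ℕ) : Prop :=
  ∃ j, 1 ≤ j ∧ j ≤ L.length ∧ i = readState d L.length j ∧
    ∃ z, ReflTransGen (CopyStep S d L) v z ∧ ReadWalk S d ((orient d L).take j) z x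

theorem readState_eq_finalState {j : ℕ} (h2 : j ≤ L.length) :
    readState d L.length j = finalState d L ↔ j = L.length := by
  cases d <;> simp only [readState, finalState]
  omega

theorem readState_length : readState d L.length L.length = finalState d L := by
  cases d <;> simp [readState, finalState]

theorem nextState_readState {j : ℕ} (hlt : j < L.length) :
    nextState d L (readState d L.length j) = readState d L.length (j + 1) := by
  cases d
  · have h : L.length - j + 1 - 1 ≠ 0 := by omega
    have h' : L.length - j + 1 - 1 = L.length - (j + 1) + 1 := by omega
    exact (if_neg h).trans h'
  · exact if_neg hlt.ne

theorem nextState_finalState (hne : L ≠ []) :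
    nextState d L (finalState d L) = readState d L.length 1 := by
  have := List.length_pos_iff.2 hne
  cases d <;> simp [readState, nextState, finalState]
  omega

theorem getElem?_readState {j : ℕ} (h1 : 1 ≤ j) (h2 : j ≤ L.length) :
    L[readState d L.length j - 1]? = (orient d L)[j - 1]? := by
  cases d
  · simp only [readState, orient]
    rw [List.getElem?_reverse (by omega)]
    congr 1; omega
  · rfl

theorem stateWalk_finalState (hne : L ≠ []) {x : V}
    (h : TransGen (CopyStep S d L) v x) : StateWalk S d v L x (finalState d L) := by
  obtain ⟨z, hz, hx⟩ := TransGen.tail'_iff.1 h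
  refine ⟨L.length, List.length_pos_iff.2 hne, le_rfl, readState_length.symm, z, hz, ?_⟩
  rw [List.take_of_length_le (by simp)]
  exact hx

theorem StateWalk.transGen {x : V} (h : StateWalk S d v L x (finalState d L)) :
    TransGen (CopyStep S d L) v x := by
  obtain ⟨j, h1, h2, hi, z, hz, hx⟩ := h
  obtain rfl := (readState_eq_finalState h2).1 hi.symm
  rw [List.take_of_length_le (by simp)] at hx
  exact TransGen.tail' hz hx

theorem StateWalk.next (hne : L ≠ []) {x y : V} {i : ℕ} {a : Lab} (h : StateWalk S d v L x i)
    (he : (y, a) ∈ S.adj d x) (ha : L[nextState d L i - 1]? = some a) :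
    StateWalk S d v L y (nextState d L i) := by
  have hpos := List.length_pos_iff.2 hne
  obtain ⟨j, h1, h2, rfl, z, hz, hx⟩ := h
  rcases h2.eq_or_lt with rfl | hlt
  · rw [readState_length, nextState_finalState hne] at ha ⊢
    rw [getElem?_readState le_rfl hpos] at ha
    have hz' : ReflTransGen (CopyStep S d L) v x := by
      rw [List.take_of_length_le (by simp)] at hx
      exact hz.tail hx
    refine ⟨1, le_rfl, hpos, rfl, x, hz', ?_⟩
    rw [List.take_add_one, ha]
    simpa using (readWalk_singleton S d a x y).2 he
  · rw [nextState_readState hlt] at ha ⊢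
    rw [getElem?_readState (by omega) hlt, Nat.succ_sub_one] at ha
    refine ⟨j + 1, by omega, hlt, rfl, z, hz, ?_⟩
    rw [List.take_add_one, ha, readWalk_append]
    exact ⟨x, hx, (readWalk_singleton S d a x y).2 he⟩

/-! ### Insertion of index entries -/

/-- The entries at `y` that searches in direction `d` write: `L_out(y)` for the backward
direction, `L_in(y)` for the forward direction. -/
def Index.get (d : Dir) (I : Index V Lab) (y : V) : Finset (V × List Lab) :=
  match d with
  | .backward => I.lout y
  | .forward => I.lin y

/-- `J` arises from `I` by a search from `v` in direction `d`: all new entries are entries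
`(v, L)` on the side of `d`, at vertices `y` with `Q L y`. -/
structure Grows (d : Dir) (v : V) (Q : List Lab → V → Prop) (I J : Index V Lab) : Prop where
  get_flip : ∀ y, J.get d.flip y = I.get d.flip y
  mono : ∀ y, I.get d y ⊆ J.get d y
  new : ∀ y x L, (x, L) ∈ J.get d y → (x, L) ∈ I.get d y ∨ (x = v ∧ Q L y)

theorem Grows.refl {Q : List Lab → V → Prop} (I : Index V Lab) : Grows d v Q I I :=
  ⟨fun _ => rfl, fun _ => subset_rfl, fun _ _ _ h => .inl h⟩

theorem Grows.trans {Q : List Lab → V → Prop} {I J K : Index V Lab} (h₁ : Grows d v Q I J)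
    (h₂ : Grows d v Q J K) : Grows d v Q I K :=
  ⟨fun y => (h₂.get_flip y).trans (h₁.get_flip y), fun y => (h₁.mono y).trans (h₂.mono y),
    fun y x L h => (h₂.new y x L h).elim (h₁.new y x L) .inr⟩

theorem Grows.imp {Q R : List Lab → V → Prop} {I J : Index V Lab} (h : Grows d v Q I J)
    (hQR : ∀ L y, Q L y → R L y) : Grows d v R I J :=
  ⟨h.get_flip, h.mono, fun y x L hx => (h.new y x L hx).imp_right (And.imp_right (hQR L y))⟩

variable [DecidableEq V]

/-- The reasons, other than the presence of the entry itself, for which the search from `v` in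
direction `d` does not write the entry `(v, L)` at `y`. -/
def Blocked (S : Schedule G) (d : Dir) (v y : V) (L : List Lab) (I : Index V Lab) : Prop :=
  S.aid y < S.aid v ∨ (y, L) ∈ I.get d.flip v ∨
    ∃ x, x ≠ v ∧ (x, L) ∈ I.get d y ∧ (x, L) ∈ I.get d.flip v

theorem Blocked.grows {Q : List Lab → V → Prop} {I J : Index V Lab} {w y : V}
    (h : Blocked S d w y L I) (hg : Grows d v Q I J) : Blocked S d w y L J := by
  rcases h with h | h | ⟨x, hx, h1, h2⟩
  · exact .inl h
  · exact .inr (.inl (by rwa [hg.get_flip]))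
  · exact .inr (.inr ⟨x, hx, hg.mono y h1, by rwa [hg.get_flip]⟩)

/-! ### Closure of the visited set -/

/-- The kernel-BFS has taken care of `y` in state `i`: it is visited or pruned. -/
def Handled (S : Schedule G) (d : Dir) (v : V) (L : List Lab) (I : Index V Lab)
    (visited : Finset (V × ℕ)) (y : V) (i : ℕ) : Prop :=
  (y, i) ∈ visited ∨ (i = finalState d L ∧ Blocked S d v y L I)

/-- All edges at `x` that read the next label after state `i` have been taken care of. -/
def Expanded (S : Schedule G) (d : Dir) (v : V) (L : List Lab) (I : Index V Lab)
    (visited : Finset (V × ℕ)) (x : V) (i : ℕ) : Prop :=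
  ∀ y a, (y, a) ∈ S.adj d x → L[nextState d L i - 1]? = some a →
    Handled S d v L I visited y (nextState d L i)

theorem Handled.mono {Q : List Lab → V → Prop} {I J : Index V Lab} {vis vis' : Finset (V × ℕ)}
    {y : V} {i : ℕ} (h : Handled S d v L I vis y i) (hg : Grows d v Q I J) (hv : vis ⊆ vis') :
    Handled S d v L J vis' y i :=
  h.imp (fun h' => hv h') (And.imp_right fun h' => h'.grows hg)

theorem Expanded.mono {Q : List Lab → V → Prop} {I J : Index V Lab} {vis vis' : Finset (V × ℕ)}
    {x : V} {i : ℕ} (h : Expanded S d v L I vis x i) (hg : Grows d v Q I J) (hv : vis ⊆ vis') :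
    Expanded S d v L J vis' x i :=
  fun y a he ha => (h y a he ha).mono hg hv

/-- Invariant of the kernel-BFS from `v` for `L` that starts with the index `I₀` and the frontier
`F`. The set `E` holds the pairs (vertex, state) whose edges are being looked at. By `mark`, an
insertion is never refused because of the entry `(v, L)` itself unless the vertex is visited. -/
structure BFSInv (S : Schedule G) (d : Dir) (v : V) (L : List Lab) (F : Finset V)
    (I₀ : Index V Lab) (E : Set (V × ℕ)) (st : BFSState V Lab) : Prop where
  walk : ∀ x i, (x, i) ∈ st.queue → StateWalk S d v L x i
  grows : Grows d v (fun M y => M = L ∧ Sound S d v L y) I₀ st.index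
  mark : ∀ y, (v, L) ∈ st.index.get d y → (y, finalState d L) ∈ st.visited
  added : ∀ y, (y, finalState d L) ∈ st.visited → y ∈ F ∨ (v, L) ∈ st.index.get d y
  closed : ∀ x i, (x, i) ∈ st.visited →
    (x, i) ∈ st.queue ∨ (x, i) ∈ E ∨ Expanded S d v L st.index st.visited x i

/-- Following one copy of `L` from a vertex visited in the final state, a finished kernel-BFS has
visited the other end, unless it is blocked there. -/
theorem BFSInv.visited_of_copyStep (hne : L ≠ []) {F : Finset V} {I₀ I : Index V Lab}
    {visited : Finset (V × ℕ)} (h : BFSInv S d v L F I₀ ∅ ⟨I, visited, []⟩) {x y : V}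
    (hx : (x, finalState d L) ∈ visited) (hxy : CopyStep S d L x y) :
    (y, finalState d L) ∈ visited ∨ Blocked S d v y L I := by
  have hpos := List.length_pos_iff.2 hne
  have hclosed : ∀ x i, (x, i) ∈ visited → Expanded S d v L I visited x i := by
    intro x i hx
    rcases h.closed x i hx with h' | h' | h'
    · simp at h'
    · exact absurd h' (Set.notMem_empty _)
    · exact h'
  have key : ∀ j, 1 ≤ j → j ≤ L.length → ∀ y, ReadWalk S d ((orient d L).take j) x y →
      Handled S d v L I visited y (readState d L.length j) := by
    intro j hj
    induction j, hj using Nat.le_induction with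
    | base =>
      intro _ y hy
      have hlt : 0 < (orient d L).length := by simpa using hpos
      rw [List.take_add_one, List.getElem?_eq_getElem hlt] at hy
      have hc := hclosed x _ hx y _ ((readWalk_singleton S d _ x y).1 (by simpa using hy))
      rw [nextState_finalState hne, getElem?_readState le_rfl hpos] at hc
      exact hc (List.getElem?_eq_getElem hlt)
    | succ j hj ih =>
      intro hj' y hy
      have hlt : j < (orient d L).length := by simpa using hj'
      rw [List.take_add_one, List.getElem?_eq_getElem hlt, readWalk_append] at hy
      obtain ⟨z, hz, hy⟩ := hy
      rcases ih (by omega) z hz with hz | ⟨hz, -⟩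
      · have hc := hclosed z _ hz y _ ((readWalk_singleton S d _ z y).1 (by simpa using hy))
        rw [nextState_readState (by omega), getElem?_readState (by omega) hj',
          Nat.add_sub_cancel] at hc
        exact hc (List.getElem?_eq_getElem hlt)
      · have := (readState_eq_finalState (by omega)).1 hz
        omega
  have hy := key L.length hpos le_rfl y
    (by rw [List.take_of_length_le (by simp)]; exact hxy)
  rw [readState_length] at hy
  exact hy.imp_right And.right

/-! ### Outcomes of an insertion -/

variable [Fintype V] [DecidableEq Lab] {k : ℕ}

/-- Both outcomes of an insertion, uniformly in the direction. -/
theorem insertEntry_cases (S : Schedule G) (d : Dir) (v y : V) (L : List Lab)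
    (I : Index V Lab) :
    (insertEntry S d v y L I = (I, false) ∧ ((v, L) ∈ I.get d y ∨ Blocked S d v y L I)) ∨
    ((insertEntry S d v y L I).2 = true ∧
      (∀ z, (insertEntry S d v y L I).1.get d.flip z = I.get d.flip z) ∧
      ∀ z, (insertEntry S d v y L I).1.get d z =
        if z = y then insert (v, L) (I.get d z) else I.get d z) := by
  cases d
  · by_cases h : S.aid v > S.aid y ∨ Query I y v L
    · refine .inl ⟨by simp only [insertEntry, if_pos h], ?_⟩
      rcases h with h | (h | h) | ⟨x, h1, h2⟩
      · exact .inr (.inl h)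
      · exact .inl h
      · exact .inr (.inr (.inl h))
      · rcases eq_or_ne x v with rfl | hx
        · exact .inl h1
        · exact .inr (.inr (.inr ⟨x, hx, h1, h2⟩))
    · refine .inr ?_
      simp only [insertEntry, if_neg h]
      refine ⟨trivial, fun z => rfl, fun z => ?_⟩
      by_cases hz : z = y
      · subst hz; simp [Index.get]
      · simp [Index.get, hz]
  · by_cases h : S.aid v > S.aid y ∨ Query I v y L
    · refine .inl ⟨by simp only [insertEntry, if_pos h], ?_⟩
      rcases h with h | (h | h) | ⟨x, h1, h2⟩
      · exact .inr (.inl h)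
      · exact .inr (.inr (.inl h))
      · exact .inl h
      · rcases eq_or_ne x v with rfl | hx
        · exact .inl h2
        · exact .inr (.inr (.inr ⟨x, hx, h2, h1⟩))
    · refine .inr ?_
      simp only [insertEntry, if_neg h]
      refine ⟨trivial, fun z => rfl, fun z => ?_⟩
      by_cases hz : z = y
      · subst hz; simp [Index.get]
      · simp [Index.get, hz]

theorem grows_insertEntry {Q : List Lab → V → Prop} {y : V} (hQ : Q L y) (I : Index V Lab) :
    Grows d v Q I (insertEntry S d v y L I).1 := by
  rcases insertEntry_cases S d v y L I with ⟨h, -⟩ | ⟨-, h1, h2⟩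
  · rw [h]; exact .refl I
  · refine ⟨h1, fun z => ?_, fun z x M hx => ?_⟩
    · rw [h2]; split_ifs
      · exact Finset.subset_insert _ _
      · exact subset_rfl
    · rw [h2] at hx
      split_ifs at hx with hz
      · rcases Finset.mem_insert.1 hx with hx | hx
        · obtain ⟨rfl, rfl⟩ := Prod.mk.inj hx
          subst hz
          exact .inr ⟨rfl, hQ⟩
        · exact .inl hx
      · exact .inl hx

theorem insertEntry_eq_of_snd_false {y : V} {I : Index V Lab}
    (h : (insertEntry S d v y L I).2 = false) :
    (insertEntry S d v y L I).1 = I ∧ ((v, L) ∈ I.get d y ∨ Blocked S d v y L I) := by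
  rcases insertEntry_cases S d v y L I with ⟨h', hb⟩ | ⟨h', -⟩
  · exact ⟨by rw [h'], hb⟩
  · simp [h] at h'

theorem mem_get_of_snd_ne_false {y : V} {I : Index V Lab}
    (h : (insertEntry S d v y L I).2 ≠ false) :
    (v, L) ∈ (insertEntry S d v y L I).1.get d y := by
  rcases insertEntry_cases S d v y L I with ⟨h', -⟩ | ⟨-, -, h2⟩
  · simp [h'] at h
  · rw [h2, if_pos rfl]; exact Finset.mem_insert_self _ _

/-- After an attempt to insert, the entry is there or there is another reason against it. -/
theorem mem_get_or_blocked_insertEntry (S : Schedule G) (d : Dir) (v y : V) (L : List Lab)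
    (I : Index V Lab) :
    (v, L) ∈ (insertEntry S d v y L I).1.get d y ∨
      Blocked S d v y L (insertEntry S d v y L I).1 := by
  by_cases h : (insertEntry S d v y L I).2 = false
  · obtain ⟨h1, h2⟩ := insertEntry_eq_of_snd_false h
    rwa [h1]
  · exact .inl (mem_get_of_snd_ne_false h)

theorem mem_get_insertEntry {y z : V} {M : List Lab} {I : Index V Lab}
    (h : (v, M) ∈ (insertEntry S d v y L I).1.get d z) :
    (v, M) ∈ I.get d z ∨ (M = L ∧ z = y) := by
  have hg : Grows d v (fun M' y' => M' = L ∧ y' = y) I (insertEntry S d v y L I).1 :=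
    grows_insertEntry ⟨rfl, rfl⟩ I
  exact (hg.new z v M h).imp_right And.right

/-! ### Kernel-search -/

/-- Invariant of the kernel-search from `v` that starts with the index `I₀`. The last field says
that an entry with root `v` is accompanied by a frontier mark. -/
structure SearchInv (S : Schedule G) (d : Dir) (v : V) (I₀ : Index V Lab)
    (st : SearchState V Lab) : Prop where
  walk : ∀ x seq, (x, seq) ∈ st.queue → ReadWalk S d (orient d seq) v x
  grows : Grows d v (Sound S d v) I₀ st.index
  sound : ∀ L y, (L, y) ∈ st.map → Sound S d v L y
  tried : ∀ L y, (L, y) ∈ st.map → (v, L) ∈ st.index.get d y ∨ Blocked S d v y L st.index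
  mark : ∀ L y, (v, L) ∈ st.index.get d y → (L, y) ∈ st.map

theorem SearchInv.searchEdge {I₀ : Index V Lab} {st : SearchState V Lab}
    (h : SearchInv S d v I₀ st) {x : V} {seq : List Lab} {e : V × Lab}
    (hx : ReadWalk S d (orient d seq) v x) (he : e ∈ S.adj d x) :
    SearchInv S d v I₀ (searchEdge S k d v seq st e) := by
  have hw : ReadWalk S d (orient d (extendSeq d e.2 seq)) v e.1 := by
    rw [orient_extendSeq, readWalk_append]
    exact ⟨x, hx, (readWalk_singleton S d _ _ _).2 he⟩
  have hne : extendSeq d e.2 seq ≠ [] := by cases d <;> simp [extendSeq]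
  have hs := sound_of_readWalk S hne hw
  have hg : Grows d v (Sound S d v) st.index (RLC.searchEdge S k d v seq st e).index :=
    grows_insertEntry hs st.index
  refine ⟨fun z w hz => ?_, h.grows.trans hg, fun M y hy => ?_, fun M y hy => ?_,
    fun M y hy => ?_⟩
  · simp only [RLC.searchEdge] at hz
    split_ifs at hz
    · rcases List.mem_append.1 hz with hz | hz
      · exact h.walk z w hz
      · obtain ⟨rfl, rfl⟩ := Prod.mk.inj (List.mem_singleton.1 hz)
        exact hw
    · exact h.walk z w hz
  · rcases Finset.mem_insert.1 hy with hy | hy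
    · obtain ⟨rfl, rfl⟩ := Prod.mk.inj hy
      exact hs
    · exact h.sound M y hy
  · rcases Finset.mem_insert.1 hy with hy | hy
    · obtain ⟨rfl, rfl⟩ := Prod.mk.inj hy
      exact mem_get_or_blocked_insertEntry S d v _ _ _
    · exact (h.tried M y hy).imp (fun h' => hg.mono y h') (fun h' => h'.grows hg)
  · rcases mem_get_insertEntry hy with hy | ⟨rfl, rfl⟩
    · exact Finset.mem_insert_of_mem (h.mark M y hy)
    · exact Finset.mem_insert_self _ _

theorem SearchInv.foldl {I₀ : Index V Lab} {x : V} {seq : List Lab}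
    (hx : ReadWalk S d (orient d seq) v x) (l : List (V × Lab)) (hl : l ⊆ S.adj d x)
    {st : SearchState V Lab} (h : SearchInv S d v I₀ st) :
    SearchInv S d v I₀ (l.foldl (RLC.searchEdge S k d v seq) st) := by
  induction l generalizing st with
  | nil => exact h
  | cons e l ih =>
    exact ih (fun _ h' => hl (List.mem_cons_of_mem _ h'))
      (h.searchEdge hx (hl List.mem_cons_self))

theorem SearchInv.searchLoop {I₀ I : Index V Lab} {m : Finset (List Lab × V)}
    {q : List (V × List Lab)} (h : SearchInv S d v I₀ ⟨I, m, q⟩) :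
    SearchInv S d v I₀ ⟨(searchLoop S k d v I m q).1, (searchLoop S k d v I m q).2, []⟩ := by
  fun_induction RLC.searchLoop S k d v I m q with
  | case1 I m => exact h
  | case2 I m x seq q st ih =>
    refine ih (SearchInv.foldl (h.walk x seq List.mem_cons_self) _ (fun _ h' => h') ?_)
    exact ⟨fun z w hz => h.walk z w (List.mem_cons_of_mem _ hz), h.grows, h.sound, h.tried,
      h.mark⟩

theorem searchEdge_foldl_mono (S : Schedule G) (k : ℕ) (d : Dir) (v : V) (seq : List Lab)
    (l : List (V × Lab)) (st : SearchState V Lab) :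
    st.map ⊆ (l.foldl (searchEdge S k d v seq) st).map ∧
      st.queue ⊆ (l.foldl (searchEdge S k d v seq) st).queue := by
  induction l generalizing st with
  | nil => exact ⟨fun _ h => h, fun _ h => h⟩
  | cons e l ih =>
    obtain ⟨h1, h2⟩ := ih (searchEdge S k d v seq st e)
    refine ⟨fun p hp => h1 (Finset.mem_insert_of_mem hp), fun p hp => h2 ?_⟩
    simp only [searchEdge]
    split_ifs
    · exact List.mem_append_left _ hp
    · exact hp

theorem searchEdge_foldl_mem (S : Schedule G) (k : ℕ) (d : Dir) (v : V) (seq : List Lab)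
    (l : List (V × Lab)) (st : SearchState V Lab) {y : V} {a : Lab} (he : (y, a) ∈ l) :
    (MR (extendSeq d a seq), y) ∈ (l.foldl (searchEdge S k d v seq) st).map ∧
      ((extendSeq d a seq).length < k →
        (y, extendSeq d a seq) ∈ (l.foldl (searchEdge S k d v seq) st).queue) := by
  induction l generalizing st with
  | nil => simp at he
  | cons e l ih =>
    rcases List.mem_cons.1 he with rfl | he
    · obtain ⟨h1, h2⟩ := searchEdge_foldl_mono S k d v seq l (searchEdge S k d v seq st (y, a))
      refine ⟨h1 (Finset.mem_insert_self _ _), fun hlt => h2 ?_⟩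
      simp only [searchEdge, if_pos hlt]
      exact List.mem_append_right _ (List.mem_singleton_self _)
    · exact ih _ he

theorem subset_searchLoop (S : Schedule G) (k : ℕ) (d : Dir) (v : V) (I : Index V Lab)
    (m : Finset (List Lab × V)) (q : List (V × List Lab)) :
    m ⊆ (searchLoop S k d v I m q).2 := by
  fun_induction searchLoop S k d v I m q with
  | case1 => exact fun _ h => h
  | case2 I m x seq q st =>
    rename_i ih
    exact (searchEdge_foldl_mono S k d v seq _ _).1.trans ih

/-- Every continuation, up to length `k`, of a sequence in the queue becomes a kernel candidate. -/
theorem mem_searchLoop (S : Schedule G) (k : ℕ) (d : Dir) (v : V) (I : Index V Lab)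
    (m : Finset (List Lab × V)) (q : List (V × List Lab)) {x y : V} {seq w : List Lab}
    (hx : (x, seq) ∈ q) (hne : w ≠ []) (hw : ReadWalk S d w x y)
    (hk : seq.length + w.length ≤ k) :
    (MR (orient d (orient d seq ++ w)), y) ∈ (searchLoop S k d v I m q).2 := by
  fun_induction searchLoop S k d v I m q generalizing x seq w with
  | case1 => simp at hx
  | case2 I m x' seq' q st =>
    rename_i ih
    rcases List.mem_cons.1 hx with hx | hx
    · obtain ⟨rfl, rfl⟩ := Prod.mk.inj hx
      obtain _ | ⟨a, w⟩ := w
      · exact absurd rfl hne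
      obtain ⟨z, hz, hw⟩ := hw
      have hst := searchEdge_foldl_mem S k d v seq (S.adj d x) ⟨I, m, q⟩ hz
      have hext : orient d (orient d seq ++ a :: w) =
          orient d (orient d (extendSeq d a seq) ++ w) := by
        rw [orient_extendSeq, List.append_assoc, List.singleton_append]
      have hlen : (extendSeq d a seq).length = seq.length + 1 := by
        cases d <;> simp [extendSeq]
      rw [List.length_cons] at hk
      rw [hext]
      rcases eq_or_ne w [] with rfl | hne'
      · obtain rfl : z = y := hw
        rw [List.append_nil, orient_orient]
        exact subset_searchLoop S k d v _ _ _ hst.1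
      · have := List.length_pos_iff.2 hne'
        exact ih (hst.2 (by omega)) hne' hw (by omega)
    · exact ih ((searchEdge_foldl_mono S k d v seq' _ _).2 hx) hne hw hk

/-- Every vertex one copy of `L` away from `v` is a frontier vertex of `L`. -/
theorem mem_kernelSearch (I : Index V Lab) (hne : L ≠ []) (hM : MR L = L)
    (hk : L.length ≤ k) {y : V} (hy : CopyStep S d L v y) :
    (L, y) ∈ (kernelSearch S k d v I).2 := by
  have h := mem_searchLoop S k d v I ∅ [(v, [])] (List.mem_singleton_self _)
    (w := orient d L) (by simpa using hne) hy (by simpa using hk)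
  have h0 : orient d ([] : List Lab) = [] := by simp
  rwa [h0, List.nil_append, orient_orient, hM] at h

theorem searchInv_kernelSearch {I : Index V Lab} (hI : ∀ L y, (v, L) ∉ I.get d y) :
    SearchInv S d v I ⟨(kernelSearch S k d v I).1, (kernelSearch S k d v I).2, []⟩ := by
  refine SearchInv.searchLoop ⟨fun x seq h => ?_, .refl I, by simp, by simp,
    fun L y h => absurd h (hI L y)⟩
  obtain ⟨rfl, rfl⟩ := Prod.mk.inj (List.mem_singleton.1 h)
  cases d <;> rfl

/-! ### Kernel-BFS -/

theorem BFSInv.bfsEdge (hne : L ≠ []) (hM : MR L = L) {F : Finset V} {I₀ : Index V Lab}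
    {E : Set (V × ℕ)} {st : BFSState V Lab} (h : BFSInv S d v L F I₀ E st) {y : V} {a : Lab}
    {i : ℕ} (hy : L[i - 1]? = some a → StateWalk S d v L y i) :
    BFSInv S d v L F I₀ E (bfsEdge S d v L i st (y, a)) ∧
      Grows d v (fun M y => M = L ∧ Sound S d v L y) st.index
        (RLC.bfsEdge S d v L i st (y, a)).index ∧
      st.visited ⊆ (RLC.bfsEdge S d v L i st (y, a)).visited ∧
      (L[i - 1]? = some a → Handled S d v L (RLC.bfsEdge S d v L i st (y, a)).index
        (RLC.bfsEdge S d v L i st (y, a)).visited y i) := by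
  unfold RLC.bfsEdge
  by_cases h1 : L[i - 1]? ≠ some a ∨ (y, i) ∈ st.visited
  · rw [if_pos h1]
    exact ⟨h, .refl _, subset_rfl, fun ha => .inl (h1.resolve_left (fun h' => h' ha))⟩
  rw [if_neg h1]
  push Not at h1
  have hw := hy h1.1
  -- both ways of visiting `(y, i)`: the index grows, or stays as it is
  have visit : ∀ J : Index V Lab, Grows d v (fun M y => M = L ∧ Sound S d v L y) st.index J →
      (∀ z, (v, L) ∈ J.get d z → (v, L) ∈ st.index.get d z ∨ (z, finalState d L) = (y, i)) →
      (i = finalState d L → (v, L) ∈ J.get d y) →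
      BFSInv S d v L F I₀ E ⟨J, insert (y, i) st.visited, st.queue ++ [(y, i)]⟩ := by
    intro J hg hJ hf
    refine ⟨fun z n hz => ?_, h.grows.trans hg, fun z hz => ?_, fun z hz => ?_,
      fun z n hz => ?_⟩
    · rcases List.mem_append.1 hz with hz | hz
      · exact h.walk z n hz
      · obtain ⟨rfl, rfl⟩ := Prod.mk.inj (List.mem_singleton.1 hz)
        exact hw
    · rcases hJ z hz with hz | hz
      · exact Finset.mem_insert_of_mem (h.mark z hz)
      · exact hz ▸ Finset.mem_insert_self _ _
    · rcases Finset.mem_insert.1 hz with hz | hz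
      · obtain ⟨rfl, rfl⟩ := Prod.mk.inj hz
        exact .inr (hf rfl)
      · exact (h.added z hz).imp_right fun h' => hg.mono z h'
    · rcases Finset.mem_insert.1 hz with hz | hz
      · rw [hz]
        exact .inl (List.mem_append_right _ (List.mem_singleton_self _))
      · rcases h.closed z n hz with h' | h' | h'
        · exact .inl (List.mem_append_left _ h')
        · exact .inr (.inl h')
        · exact .inr (.inr (h'.mono hg (Finset.subset_insert _ _)))
  by_cases hi : i = finalState d L
  · subst hi
    rw [if_pos rfl]
    by_cases hr : (insertEntry S d v y L st.index).2 = false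
    · obtain ⟨hr1, hr2⟩ := insertEntry_eq_of_snd_false hr
      simp only [hr, if_true, hr1]
      refine ⟨h, .refl _, subset_rfl, fun _ => ?_⟩
      exact hr2.elim (fun h' => .inl (h.mark y h')) (fun h' => .inr ⟨rfl, h'⟩)
    · simp only [if_neg hr]
      have hg : Grows d v (fun M y => M = L ∧ Sound S d v L y) st.index
          (insertEntry S d v y L st.index).1 :=
        grows_insertEntry ⟨rfl, hne, hM, hw.transGen⟩ _
      refine ⟨visit _ hg (fun z hz => ?_) (fun _ => mem_get_of_snd_ne_false hr), hg,
        Finset.subset_insert _ _, fun _ => .inl (Finset.mem_insert_self _ _)⟩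
      exact (mem_get_insertEntry hz).imp_right fun h' => by rw [h'.2]
  · rw [if_neg hi]
    exact ⟨visit _ (.refl _) (fun _ h' => .inl h') (fun h' => absurd h' hi), .refl _,
      Finset.subset_insert _ _, fun _ => .inl (Finset.mem_insert_self _ _)⟩

theorem BFSInv.foldl (hne : L ≠ []) (hM : MR L = L) {F : Finset V} {I₀ : Index V Lab}
    {E : Set (V × ℕ)} {i : ℕ} (l : List (V × Lab))
    (hl : ∀ y a, (y, a) ∈ l → L[i - 1]? = some a → StateWalk S d v L y i)
    {st : BFSState V Lab} (h : BFSInv S d v L F I₀ E st) :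
    BFSInv S d v L F I₀ E (l.foldl (RLC.bfsEdge S d v L i) st) ∧
      Grows d v (fun M y => M = L ∧ Sound S d v L y) st.index
        (l.foldl (RLC.bfsEdge S d v L i) st).index ∧
      st.visited ⊆ (l.foldl (RLC.bfsEdge S d v L i) st).visited ∧
      ∀ y a, (y, a) ∈ l → L[i - 1]? = some a →
        Handled S d v L (l.foldl (RLC.bfsEdge S d v L i) st).index
          (l.foldl (RLC.bfsEdge S d v L i) st).visited y i := by
  induction l generalizing st with
  | nil => exact ⟨h, .refl _, subset_rfl, by simp⟩
  | cons e l ih =>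
    obtain ⟨y, a⟩ := e
    obtain ⟨h1, g1, v1, k1⟩ := h.bfsEdge hne hM (hl y a List.mem_cons_self)
    obtain ⟨h2, g2, v2, k2⟩ := ih (fun y a h' => hl y a (List.mem_cons_of_mem _ h')) h1
    refine ⟨h2, g1.trans g2, v1.trans v2, fun z b hz hb => ?_⟩
    rcases List.mem_cons.1 hz with hz | hz
    · obtain ⟨rfl, rfl⟩ := Prod.mk.inj hz
      exact (k1 hb).mono g2 v2
    · exact k2 z b hz hb

/-- At the end of a kernel-BFS the invariant holds with an empty queue, for some set of visited
pairs that contains the initial one. -/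
theorem BFSInv.bfsLoop (hne : L ≠ []) (hM : MR L = L) {F : Finset V} {I₀ I : Index V Lab}
    {visited : Finset (V × ℕ)} {q : List (V × ℕ)}
    (h : BFSInv S d v L F I₀ ∅ ⟨I, visited, q⟩) :
    ∃ visited', visited ⊆ visited' ∧
      BFSInv S d v L F I₀ ∅ ⟨bfsLoop S d v L I visited q, visited', []⟩ := by
  fun_induction RLC.bfsLoop S d v L I visited q with
  | case1 I visited => exact ⟨visited, subset_rfl, h⟩
  | case2 I visited x i q st ih =>
    have hx := h.walk x i List.mem_cons_self
    have h0 : BFSInv S d v L F I₀ {(x, i)} ⟨I, visited, q⟩ := by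
      refine ⟨fun z n hz => h.walk z n (List.mem_cons_of_mem _ hz), h.grows, h.mark, h.added,
        fun z n hz => ?_⟩
      rcases h.closed z n hz with h' | h' | h'
      · rcases List.mem_cons.1 h' with h' | h'
        · exact .inr (.inl h')
        · exact .inl h'
      · exact absurd h' (Set.notMem_empty _)
      · exact .inr (.inr h')
    obtain ⟨h1, -, v1, k1⟩ := BFSInv.foldl hne hM (S.adj d x)
      (fun y a he ha => hx.next hne he ha) h0
    have h2 : BFSInv S d v L F I₀ ∅ st := by
      refine ⟨h1.walk, h1.grows, h1.mark, h1.added, fun z n hz => ?_⟩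
      rcases h1.closed z n hz with h' | h' | h'
      · exact .inl h'
      · obtain ⟨rfl, rfl⟩ := Prod.mk.inj h'
        exact .inr (.inr k1)
      · exact .inr (.inr h')
    obtain ⟨vis', hv, hinv⟩ := ih h2
    exact ⟨vis', v1.trans hv, hinv⟩

theorem bfsInv_kernelBFS (hne : L ≠ []) (hM : MR L = L) {F : Finset V} {I : Index V Lab}
    (hF : ∀ x ∈ F, TransGen (CopyStep S d L) v x) (hI : ∀ y, (v, L) ∈ I.get d y → y ∈ F) :
    ∃ visited : Finset (V × ℕ), (∀ x ∈ F, (x, finalState d L) ∈ visited) ∧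
      BFSInv S d v L F I ∅ ⟨kernelBFS S d v L F I, visited, []⟩ := by
  have h0 : BFSInv S d v L F I ∅ ⟨I, F.image fun x => (x, finalState d L),
      (S.frontier v d L F).map fun x => (x, finalState d L)⟩ := by
    refine ⟨fun x i hx => ?_, .refl _, fun y hy => ?_, fun y hy => ?_, fun x i hx => ?_⟩
    · obtain ⟨z, hz, h⟩ := List.mem_map.1 hx
      obtain ⟨rfl, rfl⟩ := Prod.mk.inj h
      exact stateWalk_finalState hne (hF _ ((S.mem_frontier _ _ _ _ _).1 hz))
    · exact Finset.mem_image_of_mem _ (hI y hy)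
    · obtain ⟨z, hz, h⟩ := Finset.mem_image.1 hy
      obtain ⟨rfl, -⟩ := Prod.mk.inj h
      exact .inl hz
    · obtain ⟨z, hz, h⟩ := Finset.mem_image.1 hx
      obtain ⟨rfl, rfl⟩ := Prod.mk.inj h
      exact .inl (List.mem_map.2 ⟨_, (S.mem_frontier _ _ _ _ _).2 hz, rfl⟩)
  obtain ⟨vis, hv, h⟩ := BFSInv.bfsLoop hne hM h0
  exact ⟨vis, fun x hx => hv (Finset.mem_image_of_mem _ hx), h⟩

end Searches


section Build

variable {V Lab : Type*} {G : LabeledGraph V Lab} {S : Schedule G} {d : Dir} {v : V}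
  {L : List Lab}

/-! ### Inclusion and correctness of snapshots -/

/-- Inclusion of all entries of one index in another. -/
def Index.Sub (I J : Index V Lab) : Prop :=
  ∀ d y, I.get d y ⊆ J.get d y

theorem Grows.sub {Q : List Lab → V → Prop} {I J : Index V Lab} (h : Grows d v Q I J) :
    I.Sub J := by
  intro e y
  have hf := h.get_flip y
  cases d <;> cases e <;> first | exact h.mono y | exact hf.ge

/-- All entries of `I` are correct and have a root in the list `l` of processed vertices. -/
def Correct (S : Schedule G) (l : List V) (I : Index V Lab) : Prop :=
  ∀ d x y L, (x, L) ∈ I.get d y → x ∈ l ∧ Sound S d x L y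

theorem Correct.grows {l l' : List V} {I J : Index V Lab} (h : Correct S l I)
    (hg : Grows d v (Sound S d v) I J) (hl : l ⊆ l') (hv : v ∈ l') : Correct S l' J := by
  have hf : ∀ x y L, (x, L) ∈ J.get d.flip y → x ∈ l' ∧ Sound S d.flip x L y := by
    intro x y L hx
    rw [hg.get_flip] at hx
    exact (h _ _ _ _ hx).imp_left (fun h' => hl h')
  have hd : ∀ x y L, (x, L) ∈ J.get d y → x ∈ l' ∧ Sound S d x L y := by
    intro x y L hx
    rcases hg.new y x L hx with hx | ⟨rfl, hs⟩
    · exact (h _ _ _ _ hx).imp_left (fun h' => hl h')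
    · exact ⟨hv, hs⟩
  intro e
  cases d <;> cases e <;> first | exact hd | exact hf

theorem correct_empty (S : Schedule G) : Correct S [] (Index.empty V Lab) := by
  intro d x y L h
  cases d <;> simp [Index.get, Index.empty] at h

variable [Fintype V] [DecidableEq V] [DecidableEq Lab] {k : ℕ}

/-! ### Kernel-search followed by the kernel-BFSs -/

theorem grows_foldl_kernelBFS {I : Index V Lab} {m : Finset (List Lab × V)}
    (hm : ∀ L y, (L, y) ∈ m → Sound S d v L y) (l : List (List Lab))
    (hl : ∀ L ∈ l, L ≠ [] ∧ MR L = L)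
    (hI : ∀ L y, L ∈ l → (v, L) ∈ I.get d y → (L, y) ∈ m) (hnd : l.Nodup) :
    Grows d v (fun L y => L ∈ l ∧ Sound S d v L y) I
      (l.foldl (fun J L => kernelBFS S d v L ((m.filter fun p => p.1 = L).image Prod.snd) J)
        I) := by
  induction l generalizing I with
  | nil => exact .refl I
  | cons L l ih =>
    obtain ⟨vis, -, h⟩ := bfsInv_kernelBFS (S := S) (hl L List.mem_cons_self).1
      (hl L List.mem_cons_self).2 (F := (m.filter fun p => p.1 = L).image Prod.snd) (I := I)
      (by simpa using fun x hx => (hm L x hx).2.2)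
      (by simpa using fun y hy => hI L y List.mem_cons_self hy)
    have hg := h.grows
    rw [List.nodup_cons] at hnd
    refine Grows.trans (hg.imp fun M y hMy => ?_) ((ih
      (fun M hM => hl M (List.mem_cons_of_mem _ hM)) (fun M y hM hy => ?_) hnd.2).imp
      fun M y hMy => ⟨List.mem_cons_of_mem _ hMy.1, hMy.2⟩)
    · obtain ⟨rfl, hs⟩ := hMy
      exact ⟨List.mem_cons_self, hs⟩
    · rcases hg.new y v M hy with hy | ⟨-, rfl, -⟩
      · exact hI M y (List.mem_cons_of_mem _ hM) hy
      · exact absurd hM hnd.1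

/-- Soundness of the search from `v` in direction `d`. -/
theorem grows_directedSearch {I : Index V Lab} (hI : ∀ L y, (v, L) ∉ I.get d y) :
    Grows d v (Sound S d v) I (directedSearch S k d v I) := by
  have h := searchInv_kernelSearch (S := S) (k := k) hI
  refine h.grows.trans ((grows_foldl_kernelBFS h.sound _ (fun L hL => ?_)
    (fun L y _ hy => h.mark L y hy) (S.kernels_nodup _ _ _)).imp fun _ _ h' => h'.2)
  obtain ⟨⟨M, y⟩, hp, rfl⟩ := Finset.mem_image.1 ((S.mem_kernels _ _ _ _).1 hL)
  exact ⟨(h.sound M y hp).1, (h.sound M y hp).2.1⟩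

/-- Completeness of the search from `v` in direction `d` up to pruning. The set `P` holds the
vertices that the search passes at the end of a copy of `L`. -/
theorem exists_passed_directedSearch {I : Index V Lab} (hI : ∀ L y, (v, L) ∉ I.get d y)
    (hne : L ≠ []) (hM : MR L = L) (hk : L.length ≤ k) :
    ∃ P : Set V, (∀ y, CopyStep S d L v y → y ∈ P) ∧
      (∀ x y, x ∈ P → CopyStep S d L x y →
        y ∈ P ∨ Blocked S d v y L (directedSearch S k d v I)) ∧
      ∀ y ∈ P, (v, L) ∈ (directedSearch S k d v I).get d y ∨
        Blocked S d v y L (directedSearch S k d v I) := by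
  have h := searchInv_kernelSearch (S := S) (k := k) hI
  have hfirst : ∀ y, CopyStep S d L v y → (L, y) ∈ (kernelSearch S k d v I).2 :=
    fun y hy => mem_kernelSearch I hne hM hk hy
  unfold directedSearch
  generalize kernelSearch S k d v I = r at h hfirst
  obtain ⟨I₁, m⟩ := r
  simp only at h hfirst ⊢
  have hker : ∀ M, M ∈ S.kernels v d (m.image Prod.fst) ↔ ∃ y, (M, y) ∈ m := by
    simp [S.mem_kernels]
  have hnd := S.kernels_nodup v d (m.image Prod.fst)
  generalize S.kernels v d (m.image Prod.fst) = l at hker hnd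
  by_cases hL : L ∈ l
  swap
  · exact ⟨∅, fun y hy => hL ((hker L).2 ⟨y, hfirst y hy⟩), by simp, by simp⟩
  obtain ⟨l₁, l₂, rfl⟩ := List.append_of_mem hL
  rw [List.foldl_append, List.foldl_cons]
  have hgood : ∀ M ∈ l₁ ++ L :: l₂, M ≠ [] ∧ MR M = M := fun M hM' => by
    obtain ⟨y, hy⟩ := (hker M).1 hM'
    exact ⟨(h.sound M y hy).1, (h.sound M y hy).2.1⟩
  have hnd₁ := (List.nodup_append.1 hnd).1
  have hnd₂ := (List.nodup_cons.1 (List.nodup_append.1 hnd).2.1).2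
  have hL₁ : L ∉ l₁ := fun h' =>
    (List.nodup_append.1 hnd).2.2 L h' L List.mem_cons_self rfl
  have hL₂ : L ∉ l₂ := (List.nodup_cons.1 (List.nodup_append.1 hnd).2.1).1
  -- before the kernel-BFS for `L`
  have g₁ := grows_foldl_kernelBFS h.sound l₁
    (fun M hM' => hgood M (List.mem_append_left _ hM'))
    (fun M y _ hy => h.mark M y hy) hnd₁
  generalize l₁.foldl (fun J L => kernelBFS S d v L
    ((m.filter fun p => p.1 = L).image Prod.snd) J) I₁ = J₁ at g₁ ⊢
  have hmark₁ : ∀ M y, M ∉ l₁ → (v, M) ∈ J₁.get d y → (M, y) ∈ m := fun M y hM' hy =>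
    (g₁.new y v M hy).elim (h.mark M y) (fun h' => absurd h'.2.1 hM')
  -- the kernel-BFS for `L`
  obtain ⟨vis, hvis, hb⟩ := bfsInv_kernelBFS (S := S) hne hM
    (F := (m.filter fun p => p.1 = L).image Prod.snd) (I := J₁)
    (by simpa using fun x hx => (h.sound L x hx).2.2)
    (by simpa using fun y hy => hmark₁ L y hL₁ hy)
  generalize kernelBFS S d v L ((m.filter fun p => p.1 = L).image Prod.snd) J₁ = J₂ at hb ⊢
  -- after the kernel-BFS for `L`
  have g₃ := grows_foldl_kernelBFS (I := J₂) h.sound l₂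
    (fun M hM' => hgood M (List.mem_append_right _ (List.mem_cons_of_mem _ hM')))
    (fun M y hM' hy => by
      rcases hb.grows.new y v M hy with hy | ⟨-, rfl, -⟩
      · refine hmark₁ M y (fun h' => ?_) hy
        exact (List.nodup_append.1 hnd).2.2 M h' M (List.mem_cons_of_mem _ hM') rfl
      · exact absurd hM' hL₂) hnd₂
  refine ⟨{y | (y, finalState d L) ∈ vis}, fun y hy => hvis y ?_, fun x y hx hxy => ?_,
    fun y hy => ?_⟩
  · simpa using hfirst y hy
  · exact (hb.visited_of_copyStep hne hx hxy).imp_right fun h' => h'.grows g₃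
  · rcases hb.added y hy with hy | hy
    · have hy' : (L, y) ∈ m := by simpa using hy
      rcases h.tried L y hy' with h' | h'
      · exact .inl (g₃.mono y (hb.grows.mono y (g₁.mono y h')))
      · exact .inr (((h'.grows g₁).grows hb.grows).grows g₃)
    · exact .inl (g₃.mono y hy)

/-! ### The whole index -/

/-- One round of the algorithm: neither of the two searches from `v` starts with entries of root
`v` on its own side, and both keep the snapshots correct. -/
theorem kernelBasedSearch_spec {l : List V} {I : Index V Lab} (h : Correct S l I)
    (hv : v ∉ l) :
    (∀ L y, (v, L) ∉ I.get .backward y) ∧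
    (∀ L y, (v, L) ∉ (directedSearch S k .backward v I).get .forward y) ∧
    Correct S (l ++ [v]) (directedSearch S k .backward v I) ∧
    Correct S (l ++ [v]) (kernelBasedSearch S k I v) ∧
    I.Sub (kernelBasedSearch S k I v) ∧
    (directedSearch S k .backward v I).Sub (kernelBasedSearch S k I v) := by
  have hb : ∀ L y, (v, L) ∉ I.get .backward y := fun L y h' => hv (h _ _ _ _ h').1
  have gb := grows_directedSearch (S := S) (k := k) hb
  have hf : ∀ L y, (v, L) ∉ (directedSearch S k .backward v I).get .forward y := by
    intro L y h'
    have h0 := gb.get_flip y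
    simp only [Dir.flip] at h0
    rw [h0] at h'
    exact hv (h _ _ _ _ h').1
  have gf := grows_directedSearch (S := S) (k := k) hf
  have c1 : Correct S (l ++ [v]) (directedSearch S k .backward v I) :=
    h.grows gb (List.subset_append_left _ _) (by simp)
  exact ⟨hb, hf, c1, c1.grows gf (fun _ h' => h') (by simp),
    fun e y => (gb.sub e y).trans (gf.sub e y), gf.sub⟩

theorem correct_foldl (S : Schedule G) (k : ℕ) (l₀ l : List V) (I : Index V Lab)
    (hnd : (l₀ ++ l).Nodup) (h : Correct S l₀ I) :
    Correct S (l₀ ++ l) (l.foldl (kernelBasedSearch S k) I) ∧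
      I.Sub (l.foldl (kernelBasedSearch S k) I) := by
  induction l generalizing l₀ I with
  | nil => simpa using ⟨h, fun _ _ _ h' => h'⟩
  | cons v l ih =>
    have hv : v ∉ l₀ := fun h' =>
      (List.nodup_append.1 hnd).2.2 v h' v List.mem_cons_self rfl
    obtain ⟨-, -, -, hc, hs, -⟩ := kernelBasedSearch_spec (k := k) h hv
    rw [List.append_cons] at hnd ⊢
    obtain ⟨h1, h2⟩ := ih (l₀ ++ [v]) _ hnd hc
    exact ⟨h1, fun e y => (hs e y).trans (h2 e y)⟩

/-- Soundness of the index. -/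
theorem correct_buildIndex (S : Schedule G) (k : ℕ) : Correct S S.order (buildIndex S k) := by
  unfold buildIndex
  simpa using (correct_foldl S k [] S.order _ (by simpa using S.order_nodup)
    (correct_empty S)).1

/-- The moment at which `v` is processed: the entries written before have roots with a smaller
access id, and the entries written by the searches from `v` remain. -/
theorem exists_index_at (S : Schedule G) (k : ℕ) (v : V) :
    ∃ (l : List V) (I : Index V Lab), Correct S l I ∧ v ∉ l ∧
      (∀ x ∈ l, S.aid x < S.aid v) ∧ (kernelBasedSearch S k I v).Sub (buildIndex S k) := by
  obtain ⟨l₁, l₂, h⟩ := List.append_of_mem (S.mem_order v)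
  have hnd := S.order_nodup
  rw [h] at hnd
  have hv : v ∉ l₁ := fun h' => (List.nodup_append.1 hnd).2.2 v h' v List.mem_cons_self rfl
  obtain ⟨hc, -⟩ := correct_foldl S k [] l₁ _ (by simpa using (List.nodup_append.1 hnd).1)
    (correct_empty S)
  rw [List.nil_append] at hc
  obtain ⟨-, -, -, hc', -, -⟩ := kernelBasedSearch_spec (k := k) hc hv
  refine ⟨l₁, _, hc, hv, fun x hx => ?_, ?_⟩
  · simp only [Schedule.aid, h]
    rw [List.idxOf_append_of_mem hx, List.idxOf_append_of_notMem hv, List.idxOf_cons_self]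
    have := List.idxOf_lt_length_of_mem hx
    omega
  · have h2 := (correct_foldl S k (l₁ ++ [v]) l₂ _ (by simpa using hnd) hc').2
    unfold buildIndex
    rw [h, List.foldl_append, List.foldl_cons]
    exact h2

/-! ### Completeness at the vertex of smallest access id -/

/-- If the search from `v` is not blocked at any vertex `y` between `v` and `t`, then it writes
the entry `(v, L)` at `t`. Blocking at `v` itself does no harm unless `t = v`, since the walk can
be taken up again at its last passage through `v`; the predicate `X` allows this exception. -/
theorem mem_get_directedSearch_of_unblocked {I : Index V Lab}
    (hI : ∀ L y, (v, L) ∉ I.get d y) (hne : L ≠ []) (hM : MR L = L) (hk : L.length ≤ k) {t : V}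
    (hvt : TransGen (CopyStep S d L) v t) {X : V → Prop} (ht : ¬ X t)
    (hX : ∀ y, X y → y = v)
    (hub : ∀ y, ¬ X y → TransGen (CopyStep S d L) v y → ReflTransGen (CopyStep S d L) y t →
      ¬ Blocked S d v y L (directedSearch S k d v I)) :
    (v, L) ∈ (directedSearch S k d v I).get d t := by
  obtain ⟨P, h1, h2, h3⟩ := exists_passed_directedSearch (S := S) hI hne hM hk
  have key : ∀ y, TransGen (CopyStep S d L) v y → ReflTransGen (CopyStep S d L) y t →
      ¬ X y → y ∈ P := by
    intro y hy
    induction hy with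
    | single h => exact fun _ _ => h1 _ h
    | @tail x y hx hxy ih =>
      intro hyt hyX
      by_cases hxX : X x
      · rw [hX x hxX] at hxy
        exact h1 _ hxy
      · exact (h2 x y (ih (hyt.head hxy) hxX) hxy).resolve_right
          (hub y hyX (hx.tail hxy) hyt)
  exact (h3 t (key t hvt .refl ht)).resolve_right (hub t ht hvt .refl)

end Build

end RLC

theorem theorem3 {V Lab : Type*} [Fintype V] [DecidableEq V] [DecidableEq Lab]
    (G : RLC.LabeledGraph V Lab) (S : RLC.Schedule G) (k : ℕ) (hk : 1 ≤ k)
    (s t : V) (L : List Lab) (hL : L.length ≤ k) :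
    RLC.ReachesPlus G L s t ↔
      (∃ x : V, (x, L) ∈ (RLC.buildIndex S k).lout s ∧ (x, L) ∈ (RLC.buildIndex S k).lin t) ∨
      ((t, L) ∈ (RLC.buildIndex S k).lout s ∨ (s, L) ∈ (RLC.buildIndex S k).lin t) := by
  open RLC Relation in
  rw [reachesPlus_iff S]
  constructor
  · rintro ⟨hne, hM, hst⟩
    -- the vertices on walks from `s` to `t` that read copies of `L`
    let C : V → Prop := fun u => ReflTransGen (CopyStep S .forward L) s u ∧
      ReflTransGen (CopyStep S .forward L) u t
    obtain ⟨v, ⟨hsv, hvt⟩, hmin⟩ : ∃ v, C v ∧ ∀ u, C u → S.aid v ≤ S.aid u := by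
      obtain ⟨v, hv, h⟩ := Set.exists_min_image {u | C u} S.aid (Set.toFinite _)
        ⟨s, .refl, hst.to_reflTransGen⟩
      exact ⟨v, hv, h⟩
    obtain ⟨l, I, hc, hvl, hlt, hsub⟩ := exists_index_at S k v
    obtain ⟨hb, hf, hc₁, hc₂, -, hs₁⟩ := kernelBasedSearch_spec (k := k) hc hvl
    have hCl : ∀ u, C u → u ∉ l := fun u hu hul => (hmin u hu).not_gt (hlt u hul)
    -- entries written up to the end of the search from `v`, other than by `v` itself
    have hCv : ∀ u, C u → u ∈ l ++ [v] → u = v := fun u hu hul => by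
      simpa [hCl u hu] using hul
    have hout : TransGen (CopyStep S .forward L) s v → (v, L) ∈ (buildIndex S k).lout s := by
      intro h
      refine hsub .backward s (hs₁ .backward s (mem_get_directedSearch_of_unblocked hb hne hM hL
        ((transGen_copyStep_backward S L v s).2 h) (X := fun _ => False) id
        (fun _ h' => h'.elim) fun y _ hvy hys hbl => ?_))
      rw [transGen_copyStep_backward] at hvy
      have hCy : C y := by
        refine ⟨?_, hvy.to_reflTransGen.trans hvt⟩
        rcases reflTransGen_iff_eq_or_transGen.1 hys with rfl | hys
        · exact .refl
        · exact ((transGen_copyStep_backward S L y s).1 hys).to_reflTransGen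
      have g := grows_directedSearch (S := S) (k := k) hb
      rcases hbl with h' | h' | ⟨x, hxv, hx, hx'⟩
      · exact (hmin y hCy).not_gt h'
      · rw [g.get_flip] at h'
        exact hCl y hCy (hc _ _ _ _ h').1
      · obtain ⟨hxl, -, -, hxy⟩ := hc₁ _ _ _ _ hx
        obtain ⟨-, -, -, hxv'⟩ := hc₁ _ _ _ _ hx'
        rw [transGen_copyStep_backward] at hxy
        exact hxv (hCv x ⟨hCy.1.trans hxy.to_reflTransGen,
          hxv'.to_reflTransGen.trans hvt⟩ hxl)
    have hin : TransGen (CopyStep S .forward L) v t → t ≠ v →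
        (v, L) ∈ (buildIndex S k).lin t := by
      intro h htv
      -- at `v` itself the forward search may be pruned by the entry of the backward search
      refine hsub .forward t (mem_get_directedSearch_of_unblocked hf hne hM hL h
        (X := fun y => y = v) htv (fun _ h' => h') fun y hyv hvy hyt hbl => ?_)
      have hCy : C y := ⟨hsv.trans hvy.to_reflTransGen, hyt⟩
      rcases hbl with h' | h' | ⟨x, hxv, hx, hx'⟩
      · exact (hmin y hCy).not_gt h'
      · exact hyv (hCv y hCy (hc₂ _ _ _ _ h').1)
      · obtain ⟨hxl, -, -, hxy⟩ := hc₂ _ _ _ _ hx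
        obtain ⟨-, -, -, hxv'⟩ := hc₂ _ _ _ _ hx'
        have hvx := (transGen_copyStep_backward S L x v).1 hxv'
        exact hxv (hCv x ⟨hsv.trans hvx.to_reflTransGen,
          hxy.to_reflTransGen.trans hyt⟩ hxl)
    rcases eq_or_ne t v with rfl | htv
    · exact .inr (.inl (hout hst))
    have hvt' := (reflTransGen_iff_eq_or_transGen.1 hvt).resolve_left htv
    rcases reflTransGen_iff_eq_or_transGen.1 hsv with rfl | hsv'
    · exact .inr (.inr (hin hvt' htv))
    · exact .inl ⟨v, hout hsv', hin hvt' htv⟩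
  · have hc := correct_buildIndex S k
    have hout : ∀ x, (x, L) ∈ (buildIndex S k).lout s → Sound S .forward s L x := fun x hx => by
      obtain ⟨-, hne, hM, h⟩ := hc .backward x s L hx
      exact ⟨hne, hM, (transGen_copyStep_backward S L x s).1 h⟩
    have hin : ∀ x, (x, L) ∈ (buildIndex S k).lin t → Sound S .forward x L t :=
      fun x hx => (hc .forward x t L hx).2
    rintro (⟨x, hx, hx'⟩ | h | h)
    · exact ⟨(hout x hx).1, (hout x hx).2.1, (hout x hx).2.2.trans (hin x hx').2.2⟩
    · exact hout t h
    · exact hin s h
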